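/- Let $R$ be a commutative ring with $1$ and let $A$ be an associative unital $R$-algebra which is $2$-torsion free, i.e. $2a=0$ implies $a=0$ for $a\in A$. Let $n\ge 3$. Then the full matrix algebra $\mathfrak A=M_n(A)$ has the Lie higher derivation (LHD) property: every Lie higher derivation on $\mathfrak A$ is proper. Here a Lie higher derivation on an $R$-algebra $\mathfrak A$ is a sequence $\{\mathcal L_k\}_{k\ge 0}$ of $R$-linear maps $\mathfrak A\to\mathfrak A$ with $\mathcal L_0=\mathrm{id}$ and $$\mathcal L_k([x,y])=\sum_{i+j=k}[\mathcal L_i(x),\mathcal L_j(y)]\qquad(x,y\in\mathfrak A,\ k\ge 0),\qquad [x,y]=xy-yx.$$ A higher derivation is a sequence $\{\mathcal D_k\}_{k\ge 0}$ of $R$-linear maps with $\mathcal D_0=\mathrm{id}$ and $\mathcal D_k(xy)=\sum_{i+j=k}\mathcal D_i(x)\mathcal D_j(y)$ for all $x,y\in\mathfrak A$ and $k\ge0$. A Lie higher derivation $\{\mathcal L_k\}$ is proper if there are a higher derivation $\{\mathcal D_k\}$ and $R$-linear maps $\tau_k:\mathfrak A\to Z(\mathfrak A)$ $(k\ge 1)$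 into the center of $\mathfrak A$ with $\tau_k([x,y])=0$ for all $x,y\in\mathfrak A$, such that $\mathcal L_k=\mathcal D_k+\tau_k$ for all $k\ge 1$. -/

import Mathlib

open Finset

/-- An additive group is `2`-torsion free if `2 m = 0` implies `m = 0`. -/
def IsTwoTorsionFree (M : Type*) [AddCommGroup M] : Prop :=
  ∀ m : M, 2 • m = 0 → m = 0

section HigherDerivations

variable (R : Type*) {A : Type*} [CommRing R] [Ring A] [Algebra R A]

/-- A sequence `D 0, D 1, …` of `R`-linear maps on `A` with `D 0 = id` is a higher derivation if
`D k (x y) = ∑_{i + j = k} D i x * D j y` for all `x, y` and `k`. -/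
structure IsHigherDerivation (D : ℕ → A →ₗ[R] A) : Prop where
  zero : D 0 = LinearMap.id
  map_mul : ∀ (k : ℕ) (x y : A),
    D k (x * y) = ∑ p ∈ antidiagonal k, D p.1 x * D p.2 y

/-- A sequence `L 0, L 1, …` of `R`-linear maps on `A` with `L 0 = id` is a Lie higher derivation if
`L k [x, y] = ∑_{i + j = k} [L i x, L j y]` for all `x, y` and `k`, where `[x, y] = x y - y x`. -/
structure IsLieHigherDerivation (L : ℕ → A →ₗ[R] A) : Prop where
  zero : L 0 = LinearMap.id
  map_commutator : ∀ (k : ℕ) (x y : A),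
    L k (x * y - y * x) = ∑ p ∈ antidiagonal k, (L p.1 x * L p.2 y - L p.2 y * L p.1 x)

/-- `L` is proper if `L = D + τ` for a higher derivation `D` and a sequence `τ k`, `k ≥ 1`, of
center valued `R`-linear maps vanishing at commutators (with `L 0 = D 0`; the value `τ 0`
is not used). -/
def IsProperLieHigherDerivation (L : ℕ → A →ₗ[R] A) : Prop :=
  ∃ D τ : ℕ → A →ₗ[R] A,
    IsHigherDerivation R D ∧
    (∀ k, 1 ≤ k → ∀ x, τ k x ∈ Subalgebra.center R A) ∧
    (∀ k, 1 ≤ k → ∀ x y, τ k (x * y - y * x) = 0) ∧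
    L 0 = D 0 ∧ ∀ k, 1 ≤ k → L k = D k + τ k

variable (A) in
/-- The Lie higher derivation property: every Lie higher derivation on `A` is proper. -/
def HasLHDProperty : Prop :=
  ∀ L : ℕ → A →ₗ[R] A, IsLieHigherDerivation R L → IsProperLieHigherDerivation R L

end HigherDerivations

/-! ### Lie cocycles on the matrix units. -/

namespace Matrix

variable {ι A : Type*} [Fintype ι] [DecidableEq ι] [Ring A]

/-! Put `genSeries L x = ∑ L k x X^k`. A Lie higher derivation is then a Lie homomorphism from `B =
M_n(A)` to `B⟦X⟧` that lifts the identity, a higher derivation is a multiplicative one, and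
conjugation by a unit `u ∈ 1 + X B⟦X⟧` preserves both notions as well as properness.

The plan is to conjugate `L` so that it fixes the off-diagonal matrix units `e_ij`. The obstruction
at order `k` is a Lie cocycle on the matrix units, and such cocycles are inner up to a scalar matrix
on the `e_ii` (`IsLieCocycle.exists_eq_inner_add_scalar`). The images of the `e_ij` are therefore
conjugate to the `e_ij` modulo each `X^k`, and an explicit formula gives one exact conjugator
(`exists_conj_genSeries_single_eq`).

Once the `e_ij` are fixed, each `L k` commutes with `ad e_ij` and acts off the diagonal through a
single map `h k` on `A`. The `h k` form a higher derivation of `A`. Applied entrywise it agrees with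
`L` off the diagonal, and the remaining difference is central (`isProper_of_eq_off_diagonal`). -/

theorem single_mul_apply_eq_ite (i j p q : ι) (a : A) (M : Matrix ι ι A) :
    (single i j a * M) p q = if p = i then a * M j q else 0 := by
  split_ifs with h
  · subst h; simp
  · simp [h]

theorem mul_single_apply_eq_ite (i j p q : ι) (a : A) (M : Matrix ι ι A) :
    (M * single i j a) p q = if q = j then M p i * a else 0 := by
  split_ifs with h
  · subst h; simp
  · simp [h]

theorem single_mul_single_eq_ite (i j k l : ι) (a b : A) :
    single i j a * single k l b = if j = k then single i l (a * b) else 0 := by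
  split_ifs with h
  · subst h; simp
  · simp [h]

/-- A family of matrices which is the family of values at the matrix units of a Lie derivation. -/
def IsLieCocycle (d : ι → ι → Matrix ι ι A) : Prop :=
  ∀ i j k l, (single i j 1 * d k l - d k l * single i j 1) +
      (d i j * single k l 1 - single k l 1 * d i j) =
    (if j = k then d i l else 0) - (if l = i then d k j else 0)

theorem IsLieCocycle.apply {d : ι → ι → Matrix ι ι A} (hd : IsLieCocycle d)
    (i j k l p q : ι) :
    ((if p = i then d k l j q else 0) - (if q = j then d k l p i else 0)) +
      ((if q = l then d i j p k else 0) - (if p = k then d i j l q else 0)) =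
    (if j = k then d i l p q else 0) - (if l = i then d k j p q else 0) := by
  have h := congrFun (congrFun (hd i j k l) p) q
  simp only [add_apply, sub_apply, single_mul_apply_eq_ite, mul_single_apply_eq_ite, one_mul,
    mul_one] at h
  rw [h]
  split_ifs <;> simp

theorem IsLieCocycle.sub_inner {d : ι → ι → Matrix ι ι A} (hd : IsLieCocycle d)
    (b : Matrix ι ι A) :
    IsLieCocycle fun i j => d i j - (b * single i j 1 - single i j 1 * b) := by
  intro i j k l
  have h : (if j = k then d i l - (b * single i l 1 - single i l 1 * b) else 0) -
      (if l = i then d k j - (b * single k j 1 - single k j 1 * b) else 0) =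
      ((if j = k then d i l else 0) - (if l = i then d k j else 0)) -
      (b * (single i j 1 * single k l 1 - single k l 1 * single i j 1) -
        (single i j 1 * single k l 1 - single k l 1 * single i j 1) * b) := by
    simp only [single_mul_single_eq_ite, mul_one]
    split_ifs <;> noncomm_ring
  rw [h, ← hd i j k l]
  noncomm_ring

/-- A Lie cocycle with diagonal values at the diagonal matrix units. -/
theorem IsLieCocycle.eq_diagonal_of_isDiag (hA : IsTwoTorsionFree A)
    (hι : ∀ i j : ι, ∃ k, k ≠ i ∧ k ≠ j) {d : ι → ι → Matrix ι ι A} (hd : IsLieCocycle d)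
    (hdiag : ∀ i p q, p ≠ q → d i i p q = 0) :
    ∃ (β : ι → A) (z : A), ∀ i j,
      d i j = (diagonal β * single i j 1 - single i j 1 * diagonal β) +
        if i = j then diagonal fun _ => z else 0 := by
  have h2 : ∀ a : A, a = -a → a = 0 := fun a h => hA a (by rw [two_nsmul]; nth_rw 1 [h]; simp)
  have off : ∀ i j p q, i ≠ j → ¬ (p = i ∧ q = j) → d i j p q = 0 := by
    intro i j p q hij hpq
    have h1 := hd.apply i i i j p q
    have h3 := hd.apply j j i j p q
    -- Bracketing with `e_ii` and `e_jj` kills all these entries except `(j, i)`, for which it only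
    -- gives `a = -a`.
    have := h2 (d i j p q)
    have e1 := hdiag i p i
    have e2 := hdiag i j q
    have e3 := hdiag j p i
    have e4 := hdiag j j q
    grind
  have eqd : ∀ k i j, d k k i i = d k k j j := by
    intro k i j
    have key : ∀ i j, i ≠ j → i ≠ k → d k k i i = d k k j j := by
      intro i j hij hik
      have h1 := hd.apply k k i j i j
      by_cases hjk : j = k
      · have := hd.apply k k i j i j
        have := hd.apply i i i j i j
        have := off i j
        grind
      · grind
    by_cases hij : i = j
    · rw [hij]
    · by_cases hik : i = k
      · exact (key j i (Ne.symm hij) (by grind)).symm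
      · exact key i j hij hik
  have eqd' : ∀ i j k l, d i i k k = d j j l l := by
    intro i j k l
    obtain rfl | hij := eq_or_ne i j
    · exact eqd i k l
    -- In `[e_ij, e_ji] = e_ii - e_jj`, the diagonal entry at a third index `m` receives nothing
    -- from the left side.
    obtain ⟨m, hmi, hmj⟩ := hι i j
    have h1 := hd.apply i j j i m m
    have h3 := eqd i k m
    have h4 := eqd j l m
    grind
  have add : ∀ i j k, i ≠ j → j ≠ k → i ≠ k → d i j i j + d j k j k = d i k i k := by
    intro i j k hij hjk hik
    have h1 := hd.apply i j j k i k
    grind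
  have anti : ∀ i j, i ≠ j → d i j i j = - d j i j i := by
    intro i j hij
    have h1 := hd.apply i j j i i i
    have h3 := eqd' i j i i
    grind
  rcases isEmpty_or_nonempty ι with he | ⟨⟨o⟩⟩
  · exact ⟨fun _ => 0, 0, fun i => he.elim i⟩
  -- By `add` and `anti`, the entries `d i j i j` form an additive cocycle in `(i, j)`, hence equal
  -- `β i - β j` with `β` normalised at `o`.
  refine ⟨fun i => if i = o then 0 else d i o i o, d o o o o, fun i j => ?_⟩
  ext p q
  have e : (if i = j then diagonal fun _ => d o o o o else (0 : Matrix ι ι A)) p q =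
      if i = j ∧ p = q then d o o o o else 0 := by
    by_cases h : i = j <;> simp [h, diagonal_apply]
  rw [add_apply, sub_apply, diagonal_mul, mul_diagonal, e, single_apply]
  obtain rfl | hij := eq_or_ne i j
  · obtain rfl | hpq := eq_or_ne p q
    · have := eqd' i o p o
      grind
    · rw [hdiag i p q hpq, if_neg (by grind : ¬(i = p ∧ i = q))]
      simp [hpq]
  · by_cases hpq : p = i ∧ q = j
    · obtain ⟨rfl, rfl⟩ := hpq
      have h1 := add p o q
      have h3 := anti o q
      simp only [and_self, if_true, hij, if_false, mul_one, one_mul, add_zero]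
      grind
    · rw [off i j p q hij hpq, if_neg (by grind : ¬(i = p ∧ j = q))]
      simp [hij]

/-- Lie cocycles on the matrix units are inner up to a scalar matrix. -/
theorem IsLieCocycle.exists_eq_inner_add_scalar (hA : IsTwoTorsionFree A)
    (hι : ∀ i j : ι, ∃ k, k ≠ i ∧ k ≠ j) {d : ι → ι → Matrix ι ι A} (hd : IsLieCocycle d) :
    ∃ (b : Matrix ι ι A) (z : A), ∀ i j,
      d i j = (b * single i j 1 - single i j 1 * b) +
        if i = j then diagonal fun _ => z else 0 := by
  -- Column `q` of `c` is read off from `d q q`, so `[c, e_qq]` matches column `q` of `d q q` off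
  -- the diagonal. Row `q` then matches because the `e_ii` commute with each other.
  set c : Matrix ι ι A := of fun p q => if p = q then 0 else d q q p q with hc
  obtain ⟨β, z, h⟩ := (hd.sub_inner c).eq_diagonal_of_isDiag hA hι (by
    intro i p q hpq
    rw [sub_apply, sub_apply, mul_single_apply_eq_ite, single_mul_apply_eq_ite]
    simp only [hc, of_apply]
    have h1 := hd.apply p p q q p q
    have h2 := hd.apply i i q q p q
    grind)
  refine ⟨c + diagonal β, z, fun i j => ?_⟩
  rw [← sub_add_cancel (d i j) (c * single i j 1 - single i j 1 * c), h i j]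
  noncomm_ring

end Matrix

/-! ### Maps commuting with the off-diagonal `ad e_ij`. -/

namespace Matrix

variable {R ι A : Type*} [Fintype ι] [DecidableEq ι] [CommRing R] [Ring A] [Algebra R A]

/-- The image of `a e_ij` commutes with every `e_pq` that commutes with `a e_ij`, which leaves the
entry `(i, j)` and some diagonal ones. Writing `a e_ij = [a e_ik, e_kj]` with a third index `k`
removes the diagonal part, and such brackets also show that the surviving entry does not depend on
`(i, j)`. -/
theorem exists_eq_single_of_map_commutator_single (hι : ∀ i j : ι, ∃ k, k ≠ i ∧ k ≠ j)
    (g : Matrix ι ι A →ₗ[R] Matrix ι ι A)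
    (hg : ∀ i j, i ≠ j → ∀ x, g (x * single i j 1 - single i j 1 * x) =
      g x * single i j 1 - single i j 1 * g x) :
    ∃ h : A →ₗ[R] A, ∀ i j, i ≠ j → ∀ a, g (single i j a) = single i j (h a) := by
  have comm : ∀ i j, i ≠ j → ∀ a p q, p ≠ q → p ≠ j → q ≠ i →
      g (single i j a) * single p q 1 = single p q 1 * g (single i j a) := by
    intro i j hij a p q hpq hp hq
    rw [← sub_eq_zero, ← hg p q hpq]
    simp [hp.symm, hq]
  have comm' : ∀ i j, i ≠ j → ∀ a p q, p ≠ q → p ≠ j → q ≠ i → ∀ r s,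
      (if s = q then g (single i j a) r p else 0) =
        if r = p then g (single i j a) q s else 0 := by
    intro i j hij a p q hpq hp hq r s
    have := congrFun (congrFun (comm i j hij a p q hpq hp hq) r) s
    simpa only [single_mul_apply_eq_ite, mul_single_apply_eq_ite, one_mul, mul_one] using this
  have off : ∀ i j, i ≠ j → ∀ a p q, p ≠ q → ¬ (p = i ∧ q = j) → g (single i j a) p q = 0 := by
    intro i j hij a p q hpq h
    by_cases hq : q = j
    · obtain ⟨k, hki, hkj⟩ := hι p j
      have := comm' i j hij a k p hki hkj (by grind) k q
      grind
    · obtain ⟨k, hki, hkj⟩ := hι q i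
      have := comm' i j hij a q k (Ne.symm hki) hq hkj p k
      grind
  have diag : ∀ i j, i ≠ j → ∀ a k, k ≠ i → k ≠ j →
      g (single i j a) j j = g (single i j a) k k := by
    intro i j hij a k hki hkj
    have h1 := comm' i j hij a i j hij hij hij.symm i j
    have h2 := comm' i j hij a i k hki.symm hij hki i k
    grind
  have right : ∀ i j k, i ≠ j → k ≠ i → k ≠ j → ∀ a,
      g (single i j a) = single i j (g (single i k a) i k) := by
    intro i j k hij hki hkj a
    have h1 := hg k j hkj (single i k a)
    rw [single_mul_single_eq_ite, single_mul_single_eq_ite, if_pos rfl, if_neg hij.symm,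
      mul_one, sub_zero] at h1
    rw [h1]
    ext p q
    rw [sub_apply, single_mul_apply_eq_ite, mul_single_apply_eq_ite, single_apply]
    have := diag i k hki.symm a j hij.symm hkj.symm
    have := off i k hki.symm a p k
    have := off i k hki.symm a j q
    grind
  have left : ∀ i j k, i ≠ j → k ≠ i → k ≠ j → ∀ a,
      g (single i j a) i j = g (single k j a) k j := by
    intro i j k hij hki hkj a
    have h1 := hg i k hki.symm (single k j a)
    rw [single_mul_single_eq_ite, single_mul_single_eq_ite, if_pos rfl, if_neg hij.symm,
      one_mul, zero_sub, map_neg, neg_eq_iff_eq_neg] at h1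
    rw [h1, neg_apply, sub_apply, single_mul_apply_eq_ite, mul_single_apply_eq_ite]
    grind
  rcases isEmpty_or_nonempty ι with he | ⟨⟨o⟩⟩
  · exact ⟨0, fun i => he.elim i⟩
  obtain ⟨m, hmo, -⟩ := hι o o
  refine ⟨entryLinearMap R A o m ∘ₗ g ∘ₗ singleLinearMap R o m, fun i j hij a => ?_⟩
  have right' : ∀ i j k, i ≠ j → k ≠ i → g (single i j a) i j = g (single i k a) i k := by
    intro i j k hij hki
    by_cases hkj : k = j
    · rw [hkj]
    · rw [right i j k hij hki hkj]; simp
  have all : g (single i j a) i j = g (single o m a) o m := by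
    by_cases hio : i = o
    · subst hio
      exact right' i j m hij hmo
    · obtain ⟨k, hki, hko⟩ := hι i o
      rw [right' i j k hij hki, left i k o hki.symm (Ne.symm hio) hko.symm, right' o k m hko.symm hmo]
  change _ = single i j (g (single o m a) o m)
  rw [← all]
  ext p q
  rw [single_apply]
  obtain ⟨k, hki, hkj⟩ := hι i j
  rw [right i j k hij hki hkj]
  simp [single_apply]

theorem commute_of_commute_single_of_ne (hι : ∀ i j : ι, ∃ k, k ≠ i ∧ k ≠ j)
    {x : Matrix ι ι A} (hx : ∀ i j, i ≠ j → ∀ a, Commute x (single i j a)) (y : Matrix ι ι A) :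
    Commute x y := by
  rw [matrix_eq_sum_single y]
  refine Commute.sum_right _ _ _ fun i _ => Commute.sum_right _ _ _ fun j _ => ?_
  by_cases hij : i = j
  · subst hij
    obtain ⟨k, hk, -⟩ := hι i i
    have e : single i i (y i i) = single i k (y i i) * single k i (1 : A) := by simp
    rw [e]
    exact (hx i k hk.symm _).mul_right (hx k i hk _)
  · exact hx i j hij _

end Matrix

/-! ### Generating series and conjugation. -/

section Series

open PowerSeries

variable {R B : Type*} [CommRing R] [Ring B] [Algebra R B]

/-- The generating series `∑ L k x * X ^ k`. -/
noncomputable def genSeries (L : ℕ → B →ₗ[R] B) (x : B) : B⟦X⟧ := PowerSeries.mk fun k => L k x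

@[simp]
theorem coeff_genSeries (L : ℕ → B →ₗ[R] B) (x : B) (k : ℕ) : coeff k (genSeries L x) = L k x :=
  coeff_mk _ _

@[simp]
theorem constantCoeff_genSeries (L : ℕ → B →ₗ[R] B) (x : B) :
    constantCoeff (genSeries L x) = L 0 x := by
  rw [← coeff_zero_eq_constantCoeff_apply, coeff_genSeries]

theorem genSeries_sub (L : ℕ → B →ₗ[R] B) (x y : B) :
    genSeries L (x - y) = genSeries L x - genSeries L y := by
  ext; simp

theorem isHigherDerivation_iff_genSeries {D : ℕ → B →ₗ[R] B} :
    IsHigherDerivation R D ↔ D 0 = LinearMap.id ∧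
      ∀ x y, genSeries D (x * y) = genSeries D x * genSeries D y := by
  refine ⟨fun h => ⟨h.zero, fun x y => ?_⟩, fun h => ⟨h.1, fun k x y => ?_⟩⟩
  · ext k
    simp [coeff_mul, h.map_mul]
  · rw [← coeff_genSeries D, h.2, coeff_mul]
    simp

theorem isLieHigherDerivation_iff_genSeries {L : ℕ → B →ₗ[R] B} :
    IsLieHigherDerivation R L ↔ L 0 = LinearMap.id ∧
      ∀ x y, genSeries L (x * y - y * x) =
        genSeries L x * genSeries L y - genSeries L y * genSeries L x := by
  have key : ∀ k x y, coeff k (genSeries L x * genSeries L y - genSeries L y * genSeries L x) =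
      ∑ p ∈ antidiagonal k, (L p.1 x * L p.2 y - L p.2 y * L p.1 x) := by
    intro k x y
    rw [map_sub, coeff_mul, coeff_mul, Finset.sum_sub_distrib,
      ← Finset.Nat.sum_antidiagonal_swap (f := fun p => L p.2 y * L p.1 x)]
    simp
  refine ⟨fun h => ⟨h.zero, fun x y => ?_⟩, fun h => ⟨h.1, fun k x y => ?_⟩⟩
  · ext k
    rw [coeff_genSeries, key, h.map_commutator]
  · rw [← coeff_genSeries L, h.2, key]

/-- The sequence of maps with generating series `u * genSeries L x * v`. -/
noncomputable def conjSeq (u v : B⟦X⟧) (L : ℕ → B →ₗ[R] B) (k : ℕ) : B →ₗ[R] B where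
  toFun x := coeff k (u * genSeries L x * v)
  map_add' x y := by
    have : genSeries L (x + y) = genSeries L x + genSeries L y := by ext; simp
    rw [this, mul_add, add_mul, map_add]
  map_smul' r x := by
    simp only [coeff_mul, coeff_genSeries, map_smul, mul_smul_comm, ← Finset.smul_sum,
      smul_mul_assoc, RingHom.id_apply]

@[simp]
theorem genSeries_conjSeq (u v : B⟦X⟧) (L : ℕ → B →ₗ[R] B) (x : B) :
    genSeries (conjSeq u v L) x = u * genSeries L x * v := by
  ext; simp [conjSeq]

theorem conjSeq_zero {u v : B⟦X⟧} (hu : constantCoeff u = 1) (hv : constantCoeff v = 1)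
    {L : ℕ → B →ₗ[R] B} (hL : L 0 = LinearMap.id) : conjSeq u v L 0 = LinearMap.id := by
  ext x
  simp [conjSeq, hu, hv, hL]

theorem conjSeq_conjSeq {u v : B⟦X⟧} (huv : u * v = 1) (L : ℕ → B →ₗ[R] B) :
    conjSeq u v (conjSeq v u L) = L := by
  ext k x
  rw [← coeff_genSeries (conjSeq u v _), genSeries_conjSeq, genSeries_conjSeq]
  rw [show u * (v * genSeries L x * u) * v = (u * v) * genSeries L x * (u * v) by noncomm_ring]
  simp [huv]

theorem IsHigherDerivation.conj {u v : B⟦X⟧} (hu : constantCoeff u = 1)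
    (hv : constantCoeff v = 1) (hvu : v * u = 1) {D : ℕ → B →ₗ[R] B}
    (hD : IsHigherDerivation R D) : IsHigherDerivation R (conjSeq u v D) := by
  rw [isHigherDerivation_iff_genSeries] at hD ⊢
  refine ⟨conjSeq_zero hu hv hD.1, fun x y => ?_⟩
  simp only [genSeries_conjSeq, hD.2]
  calc _ = u * genSeries D x * 1 * genSeries D y * v := by noncomm_ring
    _ = _ := by rw [← hvu]; noncomm_ring

theorem IsLieHigherDerivation.conj {u v : B⟦X⟧} (hu : constantCoeff u = 1)
    (hv : constantCoeff v = 1) (hvu : v * u = 1) {L : ℕ → B →ₗ[R] B}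
    (hL : IsLieHigherDerivation R L) : IsLieHigherDerivation R (conjSeq u v L) := by
  rw [isLieHigherDerivation_iff_genSeries] at hL ⊢
  refine ⟨conjSeq_zero hu hv hL.1, fun x y => ?_⟩
  simp only [genSeries_conjSeq, hL.2]
  calc _ = u * genSeries L x * 1 * genSeries L y * v - u * genSeries L y * 1 * genSeries L x * v :=
        by noncomm_ring
    _ = _ := by rw [← hvu]; noncomm_ring

/-- The series of `τ` has central coefficients, so conjugation leaves it unchanged and only `D` is
replaced. -/
theorem IsProperLieHigherDerivation.conj {u v : B⟦X⟧} (hu : constantCoeff u = 1)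
    (hv : constantCoeff v = 1) (huv : u * v = 1) (hvu : v * u = 1) {L : ℕ → B →ₗ[R] B}
    (hL : IsProperLieHigherDerivation R L) : IsProperLieHigherDerivation R (conjSeq u v L) := by
  obtain ⟨D, τ, hD, hc, hτ, h0, h⟩ := hL
  refine ⟨_, τ, hD.conj hu hv hvu, hc, hτ, ?_, fun k hk => ?_⟩
  · rw [conjSeq_zero hu hv hD.zero, conjSeq_zero hu hv (h0.trans hD.zero)]
  · ext x
    -- `τ 0` is unconstrained, so the constant coefficient is set to `0`.
    set t : B⟦X⟧ := PowerSeries.mk fun k => if k = 0 then 0 else τ k x with ht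
    have hLD : genSeries L x = genSeries D x + t := by
      ext m
      rcases Nat.eq_zero_or_pos m with rfl | hm
      · simp [ht, h0]
      · simp [ht, h m hm, hm.ne']
    have hcomm : t * v = v * t := by
      ext m
      rw [coeff_mul, coeff_mul, ← Finset.Nat.sum_antidiagonal_swap]
      refine Finset.sum_congr rfl fun p _ => ?_
      simp only [ht, coeff_mk, Prod.fst_swap, Prod.snd_swap]
      split_ifs with hp
      · simp
      · exact ((Subalgebra.mem_center_iff.1 (hc p.2 (Nat.one_le_iff_ne_zero.2 hp) x)) _).symm
    have : u * genSeries L x * v = u * genSeries D x * v + t := by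
      rw [hLD, mul_add, add_mul, mul_assoc u t, hcomm, ← mul_assoc, huv, one_mul]
    have := congrArg (coeff k) this
    rw [← genSeries_conjSeq, ← genSeries_conjSeq, map_add, coeff_genSeries, coeff_genSeries] at this
    simpa [ht, Nat.one_le_iff_ne_zero.1 hk] using this

end Series

/-! ### Lie higher derivations fixing the off-diagonal matrix units. -/

namespace Matrix

variable {R ι A : Type*} [Fintype ι] [DecidableEq ι] [CommRing R] [Ring A] [Algebra R A]

theorem _root_.IsLieHigherDerivation.map_commutator_of_map_eq_zero {B : Type*} [Ring B]
    [Algebra R B] {L : ℕ → B →ₗ[R] B} (hL : IsLieHigherDerivation R L) {y : B}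
    (hy : ∀ k, 1 ≤ k → L k y = 0) (k : ℕ) (x : B) :
    L k (x * y - y * x) = L k x * y - y * L k x := by
  rw [hL.map_commutator, Finset.sum_eq_single (k, 0)]
  · simp [hL.zero]
  · intro p hp hne
    have : p.2 ≠ 0 := by
      rintro h
      apply hne
      rw [HasAntidiagonal.mem_antidiagonal] at hp
      ext <;> simp_all
    simp [hy p.2 (Nat.one_le_iff_ne_zero.2 this)]
  · simp

/-- Entrywise application of a higher derivation. -/
theorem isHigherDerivation_mapMatrix {h : ℕ → A →ₗ[R] A} (hh : IsHigherDerivation R h) :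
    IsHigherDerivation R fun k => (h k).mapMatrix (m := ι) (n := ι) := by
  refine ⟨?_, fun k x y => ?_⟩
  · ext x p q
    simp [hh.zero]
  · ext p q
    simp only [LinearMap.mapMatrix_apply, map_apply, mul_apply, sum_apply, map_sum, hh.map_mul]
    exact Finset.sum_comm

/-- For distinct `i, j, l`, the identity `[a e_ij, b e_jl] = ab e_il` turns the Lie rule into the
product rule. -/
theorem isHigherDerivation_of_map_single (hι : ∀ i j : ι, ∃ k, k ≠ i ∧ k ≠ j) [Nonempty ι]
    {L : ℕ → Matrix ι ι A →ₗ[R] Matrix ι ι A} (hL : IsLieHigherDerivation R L)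
    {h : ℕ → A →ₗ[R] A} (hh : ∀ k i j, i ≠ j → ∀ a, L k (single i j a) = single i j (h k a)) :
    IsHigherDerivation R h := by
  obtain ⟨i⟩ := ‹Nonempty ι›
  obtain ⟨j, hji, -⟩ := hι i i
  obtain ⟨l, hli, hlj⟩ := hι i j
  refine ⟨?_, fun k a b => ?_⟩
  · ext a
    have := congrFun (congrFun (hh 0 i j hji.symm a) i) j
    simpa [hL.zero] using this.symm
  · have h1 := hL.map_commutator k (single i j a) (single j l b)
    have h2 : single j l b * single i j a = 0 := by simp [hli]
    rw [h2, single_mul_single_same, sub_zero, hh k i l hli.symm] at h1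
    have h3 := congrFun (congrFun h1 i) l
    rw [single_apply_same, sum_apply] at h3
    rw [h3]
    refine Finset.sum_congr rfl fun p _ => ?_
    rw [hh _ i j hji.symm, hh _ j l hlj.symm]
    simp [hli]

/-- A Lie higher derivation which agrees with a higher derivation off the diagonal is proper. -/
theorem isProper_of_eq_off_diagonal (hι : ∀ i j : ι, ∃ k, k ≠ i ∧ k ≠ j)
    {L D : ℕ → Matrix ι ι A →ₗ[R] Matrix ι ι A} (hL : IsLieHigherDerivation R L)
    (hD : IsHigherDerivation R D)
    (hLD : ∀ k i j, i ≠ j → ∀ a, L k (single i j a) = D k (single i j a)) :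
    IsProperLieHigherDerivation R L := by
  have hDc : ∀ k x y, D k (x * y - y * x) =
      ∑ p ∈ antidiagonal k, (D p.1 x * D p.2 y - D p.2 y * D p.1 x) := by
    intro k x y
    rw [map_sub, hD.map_mul, hD.map_mul, Finset.sum_sub_distrib,
      ← Finset.Nat.sum_antidiagonal_swap (f := fun p => D p.2 y * D p.1 x)]
    simp
  have hdiag : ∀ k i a, (∀ m < k, ∀ x z, Commute (L m x - D m x) z) →
      ∀ z, Commute (L k (single i i a) - D k (single i i a)) z := by
    intro k i a ih z
    refine commute_of_commute_single_of_ne hι (fun p q hpq b => ?_) z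
    have h0 : L k (single i i a * single p q b - single p q b * single i i a) =
        D k (single i i a * single p q b - single p q b * single i i a) := by
      rw [single_mul_single_eq_ite, single_mul_single_eq_ite]
      split_ifs with h1 h2 h2
      · exact absurd (h1.symm.trans h2.symm) hpq
      · simpa using hLD k i q (h1 ▸ hpq) _
      · simpa using hLD k p i (h2 ▸ hpq) _
      · simp
    -- In the difference of the two expansions the terms of index below `k` in the first factor
    -- vanish by `ih`, leaving the bracket of the order-`k` difference with `b e_pq`.
    rw [hL.map_commutator, hDc, ← sub_eq_zero, ← Finset.sum_sub_distrib,
      Finset.sum_eq_single (k, 0)] at h0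
    · simp only [hL.zero, hD.zero, LinearMap.id_apply] at h0
      rw [Commute, SemiconjBy, ← sub_eq_zero, ← h0]
      noncomm_ring
    · intro r hr hne
      have hlt : r.1 < k := by
        rw [HasAntidiagonal.mem_antidiagonal] at hr
        rcases Nat.lt_or_ge r.1 k with h | h
        · exact h
        · exact absurd (Prod.ext (by simp; omega) (by simp; omega)) hne
      have := (ih r.1 hlt (single i i a) (D r.2 (single p q b))).eq
      rw [hLD r.2 p q hpq, ← sub_eq_zero.2 this]
      noncomm_ring
    · simp
  have hcent : ∀ k x z, Commute (L k x - D k x) z := by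
    intro k
    induction k using Nat.strong_induction_on with
    | _ k ih =>
      intro x z
      rw [matrix_eq_sum_single x, map_sum, map_sum, ← Finset.sum_sub_distrib]
      refine Commute.sum_left _ _ _ fun i _ => ?_
      rw [map_sum, map_sum, ← Finset.sum_sub_distrib]
      refine Commute.sum_left _ _ _ fun j _ => ?_
      by_cases hij : i = j
      · subst hij
        exact hdiag k i _ ih z
      · rw [hLD k i j hij, sub_self]
        exact Commute.zero_left z
  refine ⟨D, fun k => L k - D k, hD, fun k _ x => ?_, fun k _ x y => ?_, ?_, fun k _ => ?_⟩
  · exact Subalgebra.mem_center_iff.2 fun z => (hcent k x z).symm.eq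
  · rw [LinearMap.sub_apply, hL.map_commutator, hDc, ← Finset.sum_sub_distrib]
    refine Finset.sum_eq_zero fun p _ => ?_
    have h1 := sub_eq_zero.2 (hcent p.1 x (L p.2 y)).eq
    have h2 := sub_eq_zero.2 (hcent p.2 y (D p.1 x)).eq
    rw [← sub_zero (0 : Matrix ι ι A)]
    nth_rw 1 [← h1]
    rw [← h2]
    noncomm_ring
  · rw [hL.zero, hD.zero]
  · exact (add_sub_cancel _ _).symm

theorem isProper_of_map_matrixUnit_eq_zero (hι : ∀ i j : ι, ∃ k, k ≠ i ∧ k ≠ j) [Nonempty ι]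
    {L : ℕ → Matrix ι ι A →ₗ[R] Matrix ι ι A} (hL : IsLieHigherDerivation R L)
    (hL0 : ∀ k, 1 ≤ k → ∀ i j, i ≠ j → L k (single i j 1) = 0) :
    IsProperLieHigherDerivation R L := by
  choose h hh using fun k => exists_eq_single_of_map_commutator_single hι (L k)
    fun i j hij => hL.map_commutator_of_map_eq_zero (fun m hm => hL0 m hm i j hij) k
  refine isProper_of_eq_off_diagonal hι hL
    (isHigherDerivation_mapMatrix (isHigherDerivation_of_map_single hι hL hh))
    fun k i j hij a => ?_
  rw [hh k i j hij, LinearMap.mapMatrix_apply, map_single]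

end Matrix

/-! ### Order-by-order deformation of the matrix units. -/

namespace Matrix

open PowerSeries

variable {R ι A : Type*} [Fintype ι] [DecidableEq ι] [CommRing R] [Ring A] [Algebra R A]

theorem _root_.PowerSeries.X_pow_dvd_mul_sub_mul {B : Type*} [Ring B] {k : ℕ} {a b c d : B⟦X⟧}
    (h : X ^ k ∣ a - b) (h' : X ^ k ∣ c - d) : X ^ k ∣ a * c - b * d := by
  obtain ⟨r, hr⟩ := h
  obtain ⟨t, ht⟩ := h'
  refine ⟨r * c + b * t, ?_⟩
  have h1 : b * X ^ k = X ^ k * b := X_pow_mul.symm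
  calc a * c - b * d = (a - b) * c + b * (c - d) := by noncomm_ring
    _ = X ^ k * r * c + (b * X ^ k) * t := by rw [hr, ht, mul_assoc b]
    _ = _ := by rw [h1]; noncomm_ring

theorem _root_.PowerSeries.eq_of_forall_X_pow_dvd_sub {B : Type*} [Ring B] {a b : B⟦X⟧}
    (h : ∀ k, 1 ≤ k → X ^ k ∣ a - b) : a = b := by
  rw [← sub_eq_zero]
  ext k
  exact X_pow_dvd_iff.1 (h (k + 1) (Nat.le_add_left 1 k)) k k.lt_succ_self

theorem _root_.PowerSeries.exists_inverse_of_constantCoeff_eq_one {B : Type*} [Ring B]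
    {u : B⟦X⟧} (h : constantCoeff u = 1) :
    ∃ v, constantCoeff v = 1 ∧ u * v = 1 ∧ v * u = 1 :=
  ⟨u.invOfUnit 1, by simp, mul_invOfUnit u 1 h, invOfUnit_mul u 1 h⟩

/-- The leading error terms of a deformation of the matrix units form a Lie cocycle. -/
theorem isLieCocycle_of_genSeries_eq {L : ℕ → Matrix ι ι A →ₗ[R] Matrix ι ι A}
    (hL : IsLieHigherDerivation R L) {k : ℕ} (hk : k ≠ 0) {s : (Matrix ι ι A)⟦X⟧}
    (hs0 : constantCoeff s = 0) (hs : ∀ i j, Commute s (C (single i j 1)))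
    {w : ι → ι → (Matrix ι ι A)⟦X⟧}
    (hw : ∀ i j, genSeries L (single i j 1) =
      C (single i j 1) + (if i = j then s else 0) + X ^ k * w i j) :
    IsLieCocycle fun i j => constantCoeff (w i j) := by
  intro i j k' l
  set E : ι → ι → (Matrix ι ι A)⟦X⟧ := fun i j => C (single i j 1) + (if i = j then s else 0)
    with hE
  have hEc : ∀ i j, constantCoeff (E i j) = single i j 1 := by
    intro i j
    by_cases hij : i = j <;> simp [hE, hij, hs0]
  -- The `E i j` satisfy the Lie relations of matrix units exactly: `s` commutes with everything
  -- involved and cancels in `E i i - E j j`.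
  have hEE : E i j * E k' l - E k' l * E i j =
      (if j = k' then E i l else 0) - (if l = i then E k' j else 0) := by
    have h1 : ∀ i j, Commute (C (single i j 1)) (if k' = l then s else 0) := by
      intro i j
      split_ifs
      · exact (hs i j).symm
      · exact Commute.zero_right _
    have h2 : ∀ t, Commute s t → Commute (if i = j then s else 0) t := by
      intro t ht
      split_ifs
      · exact ht
      · exact Commute.zero_left _
    have h3 : Commute s (if k' = l then s else 0) := by
      split_ifs
      · exact Commute.refl s
      · exact Commute.zero_right _
    have h4 : E i j * E k' l - E k' l * E i j =
        C (single i j 1 * single k' l 1 - single k' l 1 * single i j 1) := by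
      simp only [hE, mul_add, add_mul, (h1 i j).eq, (h2 _ (hs k' l)).eq, (h2 _ h3).eq, map_sub,
        map_mul]
      abel
    rw [h4, single_mul_single_eq_ite, single_mul_single_eq_ite, mul_one]
    simp only [hE, map_sub]
    obtain rfl | hjk := eq_or_ne j k' <;> obtain rfl | hli := eq_or_ne l i
    · simp
    · simp [hli, hli.symm]
    · simp [hjk, hjk.symm]
    · simp [hjk, hli]
  have hX : ∀ y : (Matrix ι ι A)⟦X⟧, y * X ^ k = X ^ k * y := fun y => X_pow_mul.symm
  have hLie := (isLieHigherDerivation_iff_genSeries.1 hL).2 (single i j 1) (single k' l 1)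
  have hl : genSeries L (single i j 1 * single k' l 1 - single k' l 1 * single i j 1) =
      (if j = k' then E i l else 0) - (if l = i then E k' j else 0) +
        X ^ k * ((if j = k' then w i l else 0) - (if l = i then w k' j else 0)) := by
    have h0 : genSeries L (0 : Matrix ι ι A) = 0 := by ext; simp
    rw [single_mul_single_eq_ite, single_mul_single_eq_ite, mul_one, genSeries_sub]
    split_ifs <;> simp only [hw, h0, hE] <;> noncomm_ring
  have hr : genSeries L (single i j 1) * genSeries L (single k' l 1) -
      genSeries L (single k' l 1) * genSeries L (single i j 1) =
      E i j * E k' l - E k' l * E i j + X ^ k * ((E i j * w k' l - w k' l * E i j) +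
        (w i j * E k' l - E k' l * w i j) + X ^ k * (w i j * w k' l - w k' l * w i j)) := by
    rw [hw i j, hw k' l]
    change (E i j + _) * (E k' l + _) - (E k' l + _) * (E i j + _) = _
    simp only [mul_add, add_mul, mul_sub, ← mul_assoc, hX]
    simp only [mul_assoc]
    abel
  rw [hl, hr, hEE, add_right_inj, X_pow_mul_inj] at hLie
  have h := congrArg constantCoeff hLie
  simp only [map_add, map_sub, map_mul, hEc, map_pow, constantCoeff_X, zero_pow hk, zero_mul,
    add_zero] at h
  rw [← h]
  split_ifs <;> simp

end Matrix

/-! ### Conjugating the images back to the matrix units. -/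

namespace Matrix

open PowerSeries

variable {R ι A : Type*} [Fintype ι] [DecidableEq ι] [CommRing R] [Ring A] [Algebra R A]

/-- `L` is conjugate modulo `X ^ k` to a Lie higher derivation fixing the matrix units
up to a scalar. -/
def FixesMatrixUnitsMod (L : ℕ → Matrix ι ι A →ₗ[R] Matrix ι ι A) (k : ℕ) : Prop :=
  ∃ u v s : (Matrix ι ι A)⟦X⟧, constantCoeff u = 1 ∧ constantCoeff v = 1 ∧ u * v = 1 ∧ v * u = 1 ∧
    constantCoeff s = 0 ∧ (∀ i j, Commute s (C (single i j 1))) ∧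
    ∀ i j, X ^ k ∣ v * genSeries L (single i j 1) * u -
      (C (single i j 1) + if i = j then s else 0)

/-- The order-`k` error is `[b, e_ij]` plus a scalar matrix `Z` when `i = j`. Conjugation by `1 +
X^k b` cancels the inner part, and `X^k Z` is absorbed into `s`. -/
theorem FixesMatrixUnitsMod.succ (hA : IsTwoTorsionFree A)
    (hι : ∀ i j : ι, ∃ k, k ≠ i ∧ k ≠ j) {L : ℕ → Matrix ι ι A →ₗ[R] Matrix ι ι A}
    (hL : IsLieHigherDerivation R L) {k : ℕ} (hk : k ≠ 0) (h : FixesMatrixUnitsMod L k) :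
    FixesMatrixUnitsMod L (k + 1) := by
  obtain ⟨u, v, s, hu, hv, huv, hvu, hs0, hs, h⟩ := h
  choose w hw using h
  have hw' : ∀ i j, genSeries (conjSeq v u L) (single i j 1) =
      C (single i j 1) + (if i = j then s else 0) + X ^ k * w i j := by
    intro i j
    rw [genSeries_conjSeq, ← hw, add_sub_cancel]
  obtain ⟨b, z, hbz⟩ := (isLieCocycle_of_genSeries_eq (hL.conj hv hu huv) hk hs0 hs
    hw').exists_eq_inner_add_scalar hA hι
  have hX : ∀ y : (Matrix ι ι A)⟦X⟧, y * X ^ k = X ^ k * y := fun y => X_pow_mul.symm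
  have hc : constantCoeff (1 + X ^ k * C b) = 1 := by simp [hk]
  obtain ⟨q, hq, hmq, hqm⟩ := exists_inverse_of_constantCoeff_eq_one hc
  set Z : Matrix ι ι A := diagonal fun _ => z
  refine ⟨u * (1 + X ^ k * C b), q * v, s + X ^ k * C Z, ?_, ?_, ?_, ?_, ?_, ?_, ?_⟩
  · rw [map_mul, hu, hc, one_mul]
  · rw [map_mul, hv, hq, one_mul]
  · calc _ = u * ((1 + X ^ k * C b) * q) * v := by noncomm_ring
      _ = 1 := by rw [hmq, mul_one, huv]
  · calc _ = q * (v * u) * (1 + X ^ k * C b) := by noncomm_ring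
      _ = 1 := by rw [hvu, mul_one, hqm]
  · simp [hs0, hk]
  · intro i j
    refine (hs i j).add_left (Commute.mul_left (commute_X_pow _ k).symm ?_)
    rw [Commute, SemiconjBy, ← map_mul, ← map_mul]
    congr 1
    ext p r
    simp only [Z, diagonal_mul, mul_diagonal, single_apply]
    split_ifs <;> simp
  · intro i j
    set δ : (Matrix ι ι A)⟦X⟧ := if i = j then 1 else 0 with hδ
    have e1 : (if i = j then s else 0) = δ * s := by simp [hδ]
    have e2 : (if i = j then s + X ^ k * C Z else 0) = δ * (s + X ^ k * C Z) := by simp [hδ]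
    have hw2 : v * genSeries L (single i j 1) * u = C (single i j 1) + δ * s + X ^ k * w i j := by
      rw [← genSeries_conjSeq, hw', e1]
    -- `y` is the new error divided by `X^k`, up to the unit `q`. Its constant coefficient is the
    -- order-`k` error minus `[b, e_ij]` and the scalar part, hence zero.
    set y : (Matrix ι ι A)⟦X⟧ := w i j + (C (single i j 1) + δ * s) * C b + w i j * X ^ k * C b
      - δ * C Z - C b * (C (single i j 1) + δ * s) - C b * δ * X ^ k * C Z with hy
    have hy0 : X ∣ y := by
      rw [X_dvd_iff, hy]
      simp only [map_add, map_sub, map_mul, map_pow, constantCoeff_X, zero_pow hk, hs0,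
        constantCoeff_C, hbz i j, hδ]
      split_ifs <;> simp
      abel
    obtain ⟨y', hy'⟩ := hy0
    refine ⟨q * y', ?_⟩
    have hkey : v * genSeries L (single i j 1) * u * (1 + X ^ k * C b) -
        (1 + X ^ k * C b) * (C (single i j 1) + δ * (s + X ^ k * C Z)) = X ^ k * y := by
      rw [hw2, hy]
      have h1 := hX (C (single i j 1) + δ * s)
      have h2 := hX δ
      linear_combination (norm := noncomm_ring) h1 * C b - h2 * C Z
    have hconj : ∀ G t F : (Matrix ι ι A)⟦X⟧, q * t = 1 →
        q * v * G * (u * t) - F = q * (v * G * u * t - t * F) := by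
      intro G t F ht
      rw [mul_sub, ← mul_assoc q t F, ht, one_mul]
      simp only [mul_assoc]
    rw [e2, hconj _ _ _ hqm, hkey, hy', ← mul_assoc, hX, pow_succ, mul_assoc, mul_assoc,
      ← mul_assoc q, ← X_mul, mul_assoc]

theorem fixesMatrixUnitsMod (hA : IsTwoTorsionFree A)
    (hι : ∀ i j : ι, ∃ k, k ≠ i ∧ k ≠ j) {L : ℕ → Matrix ι ι A →ₗ[R] Matrix ι ι A}
    (hL : IsLieHigherDerivation R L) {k : ℕ} (hk : 1 ≤ k) : FixesMatrixUnitsMod L k := by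
  induction k, hk using Nat.le_induction with
  | base =>
    refine ⟨1, 1, 0, by simp, by simp, by simp, by simp, by simp, fun i j => Commute.zero_left _,
      fun i j => ?_⟩
    rw [pow_one, X_dvd_iff]
    simp [hL.zero]
  | succ k hk ih => exact ih.succ hA hι hL (Nat.one_le_iff_ne_zero.1 hk)

/-- The images of the off-diagonal matrix units under a Lie higher derivation are simultaneously
conjugate to the matrix units. -/
theorem exists_conj_genSeries_single_eq (hA : IsTwoTorsionFree A)
    (hι : ∀ i j : ι, ∃ k, k ≠ i ∧ k ≠ j) [Nonempty ι]
    {L : ℕ → Matrix ι ι A →ₗ[R] Matrix ι ι A} (hL : IsLieHigherDerivation R L) :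
    ∃ u : (Matrix ι ι A)⟦X⟧, constantCoeff u = 1 ∧ ∀ i j, i ≠ j →
      genSeries L (single i j 1) * u = u * C (single i j 1) := by
  obtain ⟨o⟩ := ‹Nonempty ι›
  obtain ⟨m, hmo, -⟩ := hι o o
  -- `Q i` plays the role of the image of `e_io`. For `i = o` the product of images is used, since
  -- the image of `e_oo` itself may carry the extra term `s`.
  set Q : ι → (Matrix ι ι A)⟦X⟧ := fun i =>
    if i = o then genSeries L (single o m 1) * genSeries L (single m o 1)
    else genSeries L (single i o 1) with hQ
  refine ⟨∑ i, Q i * C (single o i 1), ?_, fun i j hij => eq_of_forall_X_pow_dvd_sub fun k hk => ?_⟩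
  · have : ∀ i, constantCoeff (Q i * C (single o i 1)) = single i i 1 := by
      intro i
      by_cases hi : i = o
      · simp [hQ, hi, hL.zero]
      · simp [hQ, hi, hL.zero]
    rw [map_sum, Finset.sum_congr rfl fun i _ => this i, sum_single_eq_diagonal, diagonal_one]
  · obtain ⟨u, v, s, hu, hv, huv, hvu, hs0, hs, h⟩ := fixesMatrixUnitsMod hA hι hL hk
    have hP : ∀ i j, i ≠ j →
        X ^ k ∣ genSeries L (single i j 1) - u * C (single i j 1) * v := by
      intro i j hij
      obtain ⟨t, ht⟩ := h i j
      refine ⟨u * t * v, ?_⟩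
      calc _ = u * v * genSeries L (single i j 1) * (u * v) - u * C (single i j 1) * v := by
            rw [huv]; simp
        _ = u * (v * genSeries L (single i j 1) * u -
            (C (single i j 1) + if i = j then s else 0)) * v := by
            rw [if_neg hij]; noncomm_ring
        _ = _ := by rw [ht, ← mul_assoc, ← X_pow_mul (φ := u)]; noncomm_ring
    have hQ' : ∀ i, X ^ k ∣ Q i - u * C (single i o 1) * v := by
      intro i
      by_cases hi : i = o
      · have := X_pow_dvd_mul_sub_mul (hP o m hmo.symm) (hP m o hmo)
        have e : u * C (single o m 1) * v * (u * C (single m o 1) * v) =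
            u * C (single o o (1 : A)) * v := by
          calc _ = u * C (single o m 1) * (v * u) * C (single m o 1) * v := by noncomm_ring
            _ = u * C (single o m 1 * single m o 1) * v := by rw [hvu, map_mul]; noncomm_ring
            _ = _ := by simp
        rw [e] at this
        simpa [hQ, hi] using this
      · simpa [hQ, hi] using hP i o hi
    -- Modulo `X^k` the candidate conjugator is `u * W`, and `W` commutes with the matrix units, so
    -- it conjugates as `u` does. The candidate does not depend on `k`, so no limit of the `u` is
    -- needed.
    set W : (Matrix ι ι A)⟦X⟧ := ∑ i, C (single i o 1) * v * C (single o i 1) with hW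
    have hU : X ^ k ∣ (∑ i, Q i * C (single o i 1)) - u * W := by
      rw [hW, Finset.mul_sum, ← Finset.sum_sub_distrib]
      refine Finset.dvd_sum fun i _ => ?_
      have := X_pow_dvd_mul_sub_mul (hQ' i) (c := C (single o i 1)) (d := C (single o i 1))
        (by simp)
      simpa only [mul_assoc] using this
    have hWe : C (single i j 1) * W = W * C (single i j 1) := by
      rw [hW, Finset.mul_sum, Finset.sum_mul, Finset.sum_eq_single j, Finset.sum_eq_single i]
      · simp only [← mul_assoc, ← map_mul]
        rw [mul_assoc (C (single i o 1) * v), ← map_mul]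
        simp
      · intro l _ hl
        rw [mul_assoc, ← map_mul]
        simp [hl]
      · simp
      · intro l _ hl
        rw [mul_assoc, ← mul_assoc, ← map_mul]
        simp [hl.symm]
      · simp
    have h1 := X_pow_dvd_mul_sub_mul (hP i j hij) hU
    have h2 := X_pow_dvd_mul_sub_mul hU (c := C (single i j 1)) (d := C (single i j 1)) (by simp)
    have e : u * C (single i j 1) * v * (u * W) = u * W * C (single i j 1) := by
      calc _ = u * C (single i j 1) * (v * u) * W := by noncomm_ring
        _ = u * (C (single i j 1) * W) := by rw [hvu]; noncomm_ring
        _ = _ := by rw [hWe, mul_assoc]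
    rw [e] at h1
    have := dvd_sub h1 h2
    rwa [sub_sub_sub_cancel_right] at this

end Matrix

theorem mainTheorem11 {R A : Type*} [CommRing R] [Ring A] [Algebra R A]
    (hA : IsTwoTorsionFree A) (n : ℕ) (hn : 3 ≤ n) :
    HasLHDProperty R (Matrix (Fin n) (Fin n) A) := by
  intro L hL
  have hι : ∀ i j : Fin n, ∃ k, k ≠ i ∧ k ≠ j := by
    intro i j
    have : ({i, j} : Finset (Fin n)).card < (univ : Finset (Fin n)).card := by
      rw [card_univ, Fintype.card_fin]
      exact lt_of_le_of_lt card_le_two (by omega)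
    obtain ⟨k, -, hk⟩ := exists_mem_notMem_of_card_lt_card this
    simp only [mem_insert, mem_singleton, not_or] at hk
    exact ⟨k, hk⟩
  have : Nonempty (Fin n) := ⟨⟨0, by omega⟩⟩
  obtain ⟨u, hu, h⟩ := Matrix.exists_conj_genSeries_single_eq hA hι hL
  obtain ⟨v, hv, huv, hvu⟩ := PowerSeries.exists_inverse_of_constantCoeff_eq_one hu
  -- `L` is the conjugate by `u` of a sequence that fixes the off-diagonal matrix units.
  rw [← conjSeq_conjSeq huv L]
  refine (Matrix.isProper_of_map_matrixUnit_eq_zero hι (hL.conj hv hu huv)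
    fun k hk i j hij => ?_).conj hu hv huv hvu
  rw [← coeff_genSeries (conjSeq v u L), genSeries_conjSeq, mul_assoc, h i j hij, ← mul_assoc, hvu,
    one_mul, PowerSeries.coeff_C, if_neg (Nat.one_le_iff_ne_zero.1 hk)]
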